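/- All rings are commutative with identity. For a ring $R$ and integers $n,d\ge 0$, an $R$-module $E$ is called $n$-presented if there is an exact sequence $F_n\to F_{n-1}\to\cdots\to F_0\to E\to 0$ with all $F_i$ finitely generated free $R$-modules, and $R$ is called an $(n,d)$-ring if every $n$-presented $R$-module has projective dimension at most $d$. Let $(A,M)$ be a local ring (not necessarily Noetherian), let $f:A\to B$ be a ring homomorphism, and let $J$ be a proper ideal of $B$ such that $f(M)J=0$ and $J^2=0$. Assume that $J$ is not finitely generated as an ideal of the subring $f(A)+J$ of $B$. Let $$A\bowtie^f J=\{(a,f(a)+j) : a\in A,\ j\in J\}\subseteq A\times B$$ be the amalgamation of $A$ with $B$ along $J$ with respect to $f$. Let $0\le d\le 2$ be an integer, let $A_2$ be a Noetherian ring of global dimension $d$, and let $C=(A\bowtie^f J)\times A_2$. Then: 1. $C$ is a $(2,d)$-ring; 2. $C$ is not a $(1,d)$-ring; 3. if $d\in\{1,2\}$, then $C$ is not a $(2,d-1)$-ring. -/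

import Mathlib

universe u v w

namespace Amalg

section Amalgamation

variable {A : Type u} {B : Type v} [CommRing A] [CommRing B]

/-- The amalgamation `A ⋈^f J = {(a, f a + j) | a ∈ A, j ∈ J}` of `A` with `B` along the ideal `J`
with respect to `f`, as a subring of `A × B`. -/
def amalgamation (f : A →+* B) (J : Ideal B) : Subring (A × B) where
  carrier := {x | ∃ a : A, ∃ j ∈ J, x = (a, f a + j)}
  mul_mem' := by
    rintro _ _ ⟨a, j, hj, rfl⟩ ⟨b, k, hk, rfl⟩
    refine ⟨a * b, f a * k + j * (f b + k), ?_, ?_⟩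
    · exact J.add_mem (J.mul_mem_left _ hk) (J.mul_mem_right _ hj)
    · ext <;> simp only [Prod.mk_mul_mk, map_mul]
      ring
  one_mem' := ⟨1, 0, J.zero_mem, by ext <;> simp⟩
  add_mem' := by
    rintro _ _ ⟨a, j, hj, rfl⟩ ⟨b, k, hk, rfl⟩
    refine ⟨a + b, j + k, J.add_mem hj hk, ?_⟩
    ext <;> simp only [Prod.mk_add_mk, map_add]
    ring
  zero_mem' := ⟨0, 0, J.zero_mem, by ext <;> simp⟩
  neg_mem' := by
    rintro _ ⟨a, j, hj, rfl⟩
    refine ⟨-a, -j, J.neg_mem hj, ?_⟩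
    ext <;> simp only [Prod.neg_mk, map_neg]
    ring

/-- The subring `f(A) + J = {f a + j | a ∈ A, j ∈ J}` of `B`. -/
def rangeAdd (f : A →+* B) (J : Ideal B) : Subring B where
  carrier := {b | ∃ a : A, ∃ j ∈ J, b = f a + j}
  mul_mem' := by
    rintro _ _ ⟨a, j, hj, rfl⟩ ⟨b, k, hk, rfl⟩
    refine ⟨a * b, f a * k + j * (f b + k), ?_, ?_⟩
    · exact J.add_mem (J.mul_mem_left _ hk) (J.mul_mem_right _ hj)
    · simp only [map_mul]
      ring
  one_mem' := ⟨1, 0, J.zero_mem, by simp⟩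
  add_mem' := by
    rintro _ _ ⟨a, j, hj, rfl⟩ ⟨b, k, hk, rfl⟩
    refine ⟨a + b, j + k, J.add_mem hj hk, ?_⟩
    simp only [map_add]
    ring
  zero_mem' := ⟨0, 0, J.zero_mem, by simp⟩
  neg_mem' := by
    rintro _ ⟨a, j, hj, rfl⟩
    refine ⟨-a, -j, J.neg_mem hj, ?_⟩
    simp only [map_neg]
    ring

/-- `J`, which is contained in `f(A) + J`, regarded as an ideal of the ring `f(A) + J`. -/
def idealOfRangeAdd (f : A →+* B) (J : Ideal B) : Ideal (rangeAdd f J) :=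
  J.comap (rangeAdd f J).subtype

end Amalgamation

/-- An `R`-module `E` is `n`-presented if there is an exact sequence
`F_n → F_{n-1} → ⋯ → F_1 → F_0 → E → 0` with `F_i = R ^ (k i)` free of finite rank.
Here `π` is the map `F_0 → E` and `φ i` is the map `F_{i+1} → F_i`; the data in degrees above `n`
are unconstrained (they can be taken to be zero). -/
def IsNPresented (n : ℕ) (R : Type u) [CommRing R] (E : Type v) [AddCommGroup E] [Module R E] :
    Prop :=
  ∃ (k : ℕ → ℕ) (π : (Fin (k 0) → R) →ₗ[R] E)
    (φ : ∀ i : ℕ, (Fin (k (i + 1)) → R) →ₗ[R] (Fin (k i) → R)),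
    Function.Surjective π ∧
    (1 ≤ n → Function.Exact (φ 0) π) ∧
    ∀ i : ℕ, i + 2 ≤ n → Function.Exact (φ (i + 1)) (φ i)

/-- `R` is an `(n, d)`-ring if every `n`-presented `R`-module has projective dimension at most `d`.
(An `n`-presented module is finitely generated, hence isomorphic to one in the universe of `R`.) -/
def IsNDRing (n d : ℕ) (R : Type u) [CommRing R] : Prop :=
  ∀ (E : Type u) [AddCommGroup E] [Module R E], IsNPresented n R E →
    CategoryTheory.projectiveDimension (ModuleCat.of R E) ≤ d

/-- The global dimension of `R`: the least `n : ℕ∞` such that every `R`-module has projective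
dimension at most `n`. -/
noncomputable def globalDimension (R : Type u) [CommRing R] : ℕ∞ :=
  sInf {n : ℕ∞ | ∀ E : ModuleCat.{u} R, CategoryTheory.projectiveDimension E ≤ n}

end Amalg

/-! Let R = A ⋈^f J, with maximal ideal m, and let I = 0 × J. From J² = 0 the ring R is local;
adding f(M)J = 0 gives mI = 0, and I is not finitely generated because J is not over f(A) + J.
Moreover (a, f a + j) ↦ (0, j) is R-linear on m, so I is a direct summand of m. A module over C = R
× A₂ splits into an R-part and an A₂-part. If it is 2-presented, its R-part has a finitely presented
first syzygy, which forces freeness (`Module.free_of_exact_of_socle`); only A₂ then contributes to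
the projective dimension. For 0 ≠ x ∈ I, the finitely presented module R/(x) has second syzygy m,
not projective because its summand I is not, so its projective dimension exceeds 2. Finally, cyclic
A₂-modules are 2-presented over C by Noetherianity. If C were a (2,d-1)-ring, Auslander's theorem
would bound the global dimension of A₂ by d-1. -/

open CategoryTheory

/-! ### Local rings whose maximal ideal retracts onto an ideal it annihilates -/

open TensorProduct IsLocalRing in
-- The obstruction to freeness is the kernel of k ⊗ K → k ⊗ F, k the residue field. A nonzero class
-- there is given by a vector `a` over a minimal generating system of K, with a unit coordinate `a
-- i` and with image in mF. Then I·a consists of relations, while minimality puts the coordinates of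
-- every relation in m. So the i-th coordinate followed by `p` maps the finitely generated relation
-- module onto I.
theorem Module.free_of_exact_of_socle {R : Type*} [CommRing R] [IsLocalRing R]
    {I : Ideal R} (hI : ∀ t ∈ I, ∀ m ∈ maximalIdeal R, t * m = 0) (hFG : ¬ I.FG)
    (p : maximalIdeal R →ₗ[R] I) (hp : ∀ x : maximalIdeal R, (x : R) ∈ I → (p x : R) = x)
    {K F E : Type*} [AddCommGroup K] [AddCommGroup F] [AddCommGroup E]
    [Module R K] [Module R F] [Module R E] [Module.FinitePresentation R K]
    [Module.Free R F] [Module.Finite R F] (f : K →ₗ[R] F) (g : F →ₗ[R] E)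
    (hf : Function.Injective f) (hg : Function.Surjective g) (hfg : Function.Exact f g) :
    Module.Free R E := by
  classical
  have hIm : I ≤ maximalIdeal R := le_maximalIdeal (fun h ↦ hFG (h ▸ Module.Finite.fg_top))
  refine Module.free_of_lTensor_residueField_injective f g hg hfg ?_
  rw [injective_iff_map_eq_zero]
  intro y hy
  obtain ⟨x, rfl⟩ := TensorProduct.mk_surjective R K (ResidueField R) residue_surjective y
  have hx : (1 : ResidueField R) ⊗ₜ[R] f x = 0 := by simpa using hy
  by_contra hne
  let b := Module.Free.chooseBasis (ResidueField R) (ResidueField R ⊗[R] K)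
  obtain ⟨v, hv⟩ := (TensorProduct.mk_surjective R K (ResidueField R)
    residue_surjective).comp_left b
  have hv' : ∀ i, (1 : ResidueField R) ⊗ₜ[R] v i = b i := fun i ↦ congr_fun hv i
  have hspan := span_eq_top_of_tmul_eq_basis v b hv'
  let c := Fintype.linearCombination R v
  have hc : Function.Surjective c := by
    rw [← LinearMap.range_eq_top, Fintype.range_linearCombination, hspan]
  have hrepr : ∀ a i, b.repr ((1 : ResidueField R) ⊗ₜ[R] c a) i = residue R (a i) := by
    intro a i
    have : (1 : ResidueField R) ⊗ₜ[R] c a = ∑ i, residue R (a i) • b i := by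
      simp only [c, Fintype.linearCombination_apply, TensorProduct.tmul_sum, ← hv',
        TensorProduct.tmul_smul]
      refine Finset.sum_congr rfl fun i _ ↦ ?_
      rw [TensorProduct.smul_tmul', TensorProduct.smul_tmul']
      simp [Algebra.smul_def]
    rw [this, b.repr_sum_self]
  obtain ⟨a, rfl⟩ := hc x
  obtain ⟨i, hi⟩ : ∃ i, IsUnit (a i) := by
    by_contra! h
    refine hne (b.repr.injective (Finsupp.ext fun i ↦ ?_))
    have h1 := hrepr a i
    rw [(residue_eq_zero_iff _).mpr ((mem_maximalIdeal _).mpr (h i))] at h1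
    simpa using h1
  have hker : ∀ z ∈ LinearMap.ker c, z i ∈ maximalIdeal R := by
    intro z hz
    rw [← residue_eq_zero_iff, ← hrepr, LinearMap.mem_ker.mp hz]
    simp
  have hmem : ∀ t ∈ I, t • a ∈ LinearMap.ker c := by
    intro t ht
    rw [LinearMap.mem_ker, map_smul]
    apply hf
    let β := Module.Free.chooseBasis R F
    rw [map_smul, map_zero]
    refine β.repr.injective (Finsupp.ext fun k ↦ ?_)
    have h1 : (β.baseChange (ResidueField R)).repr ((1 : ResidueField R) ⊗ₜ[R] f (c a)) k = 0 := by
      rw [hx]; simp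
    rw [Module.Basis.baseChange_repr_tmul] at h1
    have h2 : β.repr (f (c a)) k ∈ maximalIdeal R := by
      rw [← residue_eq_zero_iff]
      simpa [Algebra.smul_def] using h1
    simpa using hI t ht _ h2
  let q : LinearMap.ker c →ₗ[R] I :=
    p ∘ₗ ((LinearMap.proj i ∘ₗ (LinearMap.ker c).subtype).codRestrict (maximalIdeal R)
      (fun z ↦ hker z.1 z.2))
  have hq : Function.Surjective q := by
    intro t
    obtain ⟨u, hu⟩ := hi
    -- Dividing by the unit `a i` gives a relation whose i-th coordinate is exactly t.
    have htI : (↑u⁻¹ : R) * t ∈ I := I.mul_mem_left _ t.2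
    refine ⟨⟨((↑u⁻¹ : R) * t) • a, hmem _ htI⟩, Subtype.ext ?_⟩
    have h3 : ((↑u⁻¹ : R) * t) * a i = t := by
      rw [← hu]
      calc (↑u⁻¹ : R) * t * u = (↑u⁻¹ * u) * t := by ring
        _ = t := by simp
    refine (hp _ ?_).trans ?_
    · change ((↑u⁻¹ : R) * t) * a i ∈ I
      rw [h3]; exact t.2
    · exact h3
  have : Module.Finite R (LinearMap.ker c) :=
    Module.Finite.iff_fg.mpr (Module.FinitePresentation.fg_ker c hc)
  exact hFG (Module.Finite.iff_fg.mp (Module.Finite.of_surjective q hq))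

lemma ModuleCat.hasProjectiveDimensionLE_ker_iff {R : Type u} [Ring R] [Small.{v} R]
    {P N : Type v} [AddCommGroup P] [AddCommGroup N] [Module R P] [Module R N]
    [Module.Projective R P] (g : P →ₗ[R] N) (hg : Function.Surjective g) (n : ℕ) :
    HasProjectiveDimensionLE (ModuleCat.of R N) (n + 1) ↔
      HasProjectiveDimensionLE (ModuleCat.of R (LinearMap.ker g)) n := by
  let S : ShortComplex (ModuleCat.{v} R) :=
    ModuleCat.shortComplexOfCompEqZero _ _ g.exact_subtype_ker_map.linearMap_comp_eq_zero
  have hS : S.ShortExact := ModuleCat.shortComplex_shortExact S g.exact_subtype_ker_map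
    (Submodule.injective_subtype _) hg
  exact hS.hasProjectiveDimensionLT_X₃_iff n
    (inferInstanceAs (Projective (ModuleCat.of R P)))

lemma ModuleCat.hasProjectiveDimensionLE_zero_iff {R : Type u} [Ring R] [Small.{v} R]
    {N : Type v} [AddCommGroup N] [Module R N] :
    HasProjectiveDimensionLE (ModuleCat.of R N) 0 ↔ Module.Projective R N := by
  rw [← projective_iff_hasProjectiveDimensionLE_zero, ← IsProjective.iff_projective]

open IsLocalRing in
-- The successive syzygies of R/(x) are (x) and Ann(x) = m. If m were projective, so would be its
-- summand I, which a dual basis argument excludes.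
lemma ModuleCat.not_hasProjectiveDimensionLE_two_quotient_span {R : Type u} [CommRing R]
    [IsLocalRing R] {I : Ideal R} (hI : ∀ t ∈ I, ∀ m ∈ maximalIdeal R, t * m = 0)
    (hIm : I ≤ maximalIdeal R)
    (p : maximalIdeal R →ₗ[R] I) (hp : ∀ x : maximalIdeal R, (x : R) ∈ I → (p x : R) = x)
    {x : R} (hxI : x ∈ I) (hx : x ≠ 0) :
    ¬ HasProjectiveDimensionLE (ModuleCat.of R (R ⧸ Ideal.span {x})) 2 := by
  intro h
  rw [ModuleCat.hasProjectiveDimensionLE_ker_iff (Ideal.span {x}).mkQ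
    (Submodule.mkQ_surjective _) 1] at h
  let τ := (LinearMap.toSpanSingleton R R x)
  have hτ : LinearMap.range τ = LinearMap.ker (Ideal.span {x}).mkQ := by
    rw [Submodule.ker_mkQ, LinearMap.range_toSpanSingleton]
  have h1 : HasProjectiveDimensionLE (ModuleCat.of R (LinearMap.range τ)) 1 := by rwa [hτ]
  rw [ModuleCat.hasProjectiveDimensionLE_ker_iff τ.rangeRestrict τ.surjective_rangeRestrict 0,
    LinearMap.ker_rangeRestrict, ModuleCat.hasProjectiveDimensionLE_zero_iff] at h1
  have hker : LinearMap.ker τ = maximalIdeal R := by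
    ext m
    rw [LinearMap.mem_ker, LinearMap.toSpanSingleton_apply, smul_eq_mul]
    refine ⟨fun h ↦ (mem_maximalIdeal m).mpr fun hm ↦ hx ?_, fun h ↦ ?_⟩
    · rwa [hm.mul_right_eq_zero] at h
    · rw [mul_comm, hI x hxI m h]
  rw [hker] at h1
  have hproj : Module.Projective R I :=
    Module.Projective.of_split (Submodule.inclusion hIm) p
      (LinearMap.ext fun y ↦ Subtype.ext (hp _ y.2))
  obtain ⟨s, hs⟩ := hproj.out
  have h2 := hs ⟨x, hxI⟩
  -- Since x² = 0, x kills each coordinate of `s x`, so a unit coordinate would give x = 0. As m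
  -- kills I, the dual basis expansion of x then vanishes.
  have hunit : ∀ i, s ⟨x, hxI⟩ i ∈ maximalIdeal R := by
    intro i hu
    refine hx ?_
    have h3 : x • s ⟨x, hxI⟩ = 0 := by
      rw [← map_smul]
      have : x • (⟨x, hxI⟩ : I) = 0 := Subtype.ext (hI x hxI x (hIm hxI))
      rw [this, map_zero]
    have h4 := DFunLike.congr_fun h3 i
    simpa [hu.mul_left_eq_zero] using h4
  rw [Finsupp.linearCombination_apply, Finsupp.sum, Finset.sum_eq_zero] at h2
  · exact hx (congr_arg Subtype.val h2).symm
  · intro i _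
    refine Subtype.ext ?_
    simpa [mul_comm] using hI i.1 i.2 _ (hunit i)

/-! ### Change of rings along a surjection R → S with S projective over R -/

lemma Module.Projective.restrictScalars_of_isScalarTower (R S : Type*) {N : Type*} [CommRing R]
    [CommRing S] [Algebra R S] [AddCommGroup N] [Module R N] [Module S N] [IsScalarTower R S N]
    [Module.Projective R S] [Module.Projective S N] : Module.Projective R N := by
  obtain ⟨s, hs⟩ := Module.projective_def'.mp ‹Module.Projective S N›
  have : Module.Projective R (N →₀ S) := by
    classical exact .of_equiv (finsuppLEquivDirectSum R S N).symm
  exact Module.Projective.of_split (s.restrictScalars R)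
    ((Finsupp.linearCombination S id).restrictScalars R)
    (LinearMap.ext fun n ↦ LinearMap.congr_fun hs n)

lemma Module.Projective.of_restrictScalars_of_surjective (R : Type*) {S N : Type*} [CommRing R]
    [CommRing S] [Algebra R S] (hRS : Function.Surjective (algebraMap R S))
    [AddCommGroup N] [Module R N] [Module S N] [IsScalarTower R S N] [Module.Projective R N] :
    Module.Projective S N := by
  let g := Finsupp.linearCombination S (id : N → N)
  have hg : Function.Surjective g := fun n ↦ ⟨Finsupp.single n 1, by simp [g]⟩
  obtain ⟨s, hs⟩ := Module.projective_lifting_property (g.restrictScalars R)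
    (LinearMap.id : N →ₗ[R] N) hg
  refine Module.Projective.of_split (s.extendScalarsOfSurjective hRS) g ?_
  ext n
  exact LinearMap.congr_fun hs n

/-- A free S-cover of N is also projective over R, so its kernel serves as a syzygy over both rings;
induct on n. -/
lemma ModuleCat.hasProjectiveDimensionLE_restrictScalars_iff (R : Type*) {S : Type*} [CommRing R]
    [CommRing S] [Algebra R S] [Small.{v} R] [Small.{v} S]
    (hRS : Function.Surjective (algebraMap R S)) [Module.Projective R S] (n : ℕ)
    (N : Type v) [AddCommGroup N] [Module R N] [Module S N] [IsScalarTower R S N] :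
    HasProjectiveDimensionLE (ModuleCat.of R N) n ↔
      HasProjectiveDimensionLE (ModuleCat.of S N) n := by
  induction n generalizing N with
  | zero =>
    rw [hasProjectiveDimensionLE_zero_iff, hasProjectiveDimensionLE_zero_iff]
    exact ⟨fun _ ↦ .of_restrictScalars_of_surjective R hRS, fun _ ↦ .restrictScalars_of_isScalarTower R S⟩
  | succ n ih =>
    have : IsScalarTower R S (Shrink.{v} S) :=
      ⟨fun r s t ↦ (equivShrink S).symm.injective <| by simp [equivShrink_symm_smul]⟩
    let g : (N →₀ Shrink.{v} S) →ₗ[S] N :=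
      Finsupp.linearCombination S (id : N → N) ∘ₗ
        Finsupp.mapRange.linearMap (Shrink.linearEquiv S S).toLinearMap
    have hg : Function.Surjective g := fun n ↦
      ⟨Finsupp.single n ((Shrink.linearEquiv S S).symm 1), by
        simp [g, -Shrink.linearEquiv_symm_apply]⟩
    have : Module.Projective S (N →₀ Shrink.{v} S) :=
      .of_equiv (Finsupp.mapRange.linearEquiv (Shrink.linearEquiv S S).symm)
    have : Module.Projective R (N →₀ Shrink.{v} S) := .restrictScalars_of_isScalarTower R S
    rw [hasProjectiveDimensionLE_ker_iff g hg,
      hasProjectiveDimensionLE_ker_iff (g.restrictScalars R) hg]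
    exact ih (LinearMap.ker g)

/-! ### Modules that are 1- and 2-presented -/

lemma Amalg.isNPresented_one_iff {R : Type u} [CommRing R] {E : Type v} [AddCommGroup E]
    [Module R E] : Amalg.IsNPresented 1 R E ↔ Module.FinitePresentation R E := by
  constructor
  · rintro ⟨k, π, φ, hπ, h0, -⟩
    refine Module.finitePresentation_of_surjective π hπ ?_
    rw [(h0 le_rfl).linearMap_ker_eq]
    exact Module.Finite.iff_fg.mp inferInstance
  · intro
    obtain ⟨n, m, f, g, hf, hfg⟩ := Module.FinitePresentation.exists_fin' R E
    refine ⟨fun i ↦ match i with | 0 => n | 1 => m | _ => 0, f,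
      fun i ↦ match i with | 0 => g | i + 1 => 0, hf, fun _ ↦ hfg, ?_⟩
    intro i hi
    omega

lemma Amalg.isNPresented_two_iff {R : Type u} [CommRing R] {E : Type v} [AddCommGroup E]
    [Module R E] : Amalg.IsNPresented 2 R E ↔ ∃ (n : ℕ) (f : (Fin n → R) →ₗ[R] E),
      Function.Surjective f ∧ Module.FinitePresentation R (LinearMap.ker f) := by
  constructor
  · rintro ⟨k, π, φ, hπ, h0, h1⟩
    refine ⟨k 0, π, hπ, ?_⟩
    have e := (h0 one_le_two).linearMap_ker_eq
    rw [e]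
    refine Module.finitePresentation_of_surjective (φ 0).rangeRestrict
      (φ 0).surjective_rangeRestrict ?_
    rw [LinearMap.ker_rangeRestrict, (h1 0 le_rfl).linearMap_ker_eq]
    exact Module.Finite.iff_fg.mp inferInstance
  · rintro ⟨n, f, hf, hK⟩
    obtain ⟨a, b, g, h, hg, hgh⟩ := Module.FinitePresentation.exists_fin' R (LinearMap.ker f)
    refine ⟨fun i ↦ match i with | 0 => n | 1 => a | 2 => b | _ => 0, f,
      fun i ↦ match i with | 0 => (LinearMap.ker f).subtype ∘ₗ g | 1 => h | i + 2 => 0, hf,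
      fun _ ↦ ?_, ?_⟩
    · rw [LinearMap.exact_iff, LinearMap.range_comp, LinearMap.range_eq_top.mpr hg]
      simp
    · intro i hi
      obtain rfl : i = 0 := by omega
      rw [LinearMap.exact_iff, ← hgh.linearMap_ker_eq]
      exact LinearMap.ker_comp_of_ker_eq_bot _ (Submodule.ker_subtype _)

/-- Precomposing with R^n → S^n replaces the kernel of `f` by an extension of it by `ker c`. The
latter is finitely generated projective because S^n is projective over R, so the extension stays
finitely presented. -/
lemma Amalg.IsNPresented.two_restrictScalars (R : Type*) {S : Type*} [CommRing R]
    [CommRing S] [Algebra R S] (hRS : Function.Surjective (algebraMap R S))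
    [Module.Projective R S] {N : Type*} [AddCommGroup N] [Module R N] [Module S N]
    [IsScalarTower R S N] (h : Amalg.IsNPresented 2 S N) : Amalg.IsNPresented 2 R N := by
  rw [isNPresented_two_iff] at h ⊢
  obtain ⟨n, f, hf, hK⟩ := h
  have : Module.Finite R S := .of_surjective (Algebra.linearMap R S) hRS
  have : Module.FinitePresentation R S := Module.finitePresentation_of_projective R S
  have : Module.FinitePresentation R (LinearMap.ker f) := .trans R _ S
  let c : (Fin n → R) →ₗ[R] (Fin n → S) := LinearMap.compLeft (Algebra.linearMap R S) (Fin n)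
  have hc : Function.Surjective c := hRS.comp_left
  let g : (Fin n → R) →ₗ[R] N := f.restrictScalars R ∘ₗ c
  refine ⟨n, g, hf.comp hc, ?_⟩
  let r : LinearMap.ker g →ₗ[R] LinearMap.ker (f.restrictScalars R) :=
    (c ∘ₗ (LinearMap.ker g).subtype).codRestrict _ (fun x ↦ x.2)
  have hr : Function.Surjective r := by
    rintro ⟨y, hy⟩
    obtain ⟨x, rfl⟩ := hc y
    exact ⟨⟨x, hy⟩, rfl⟩
  have : Module.FinitePresentation R (LinearMap.ker (f.restrictScalars R)) := this
  have : Module.FinitePresentation R (LinearMap.ker c) := by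
    have : Module.Projective R (Fin n → S) := .restrictScalars_of_isScalarTower R S
    have : Module.Projective R (LinearMap.ker c) := by
      obtain ⟨s, hs⟩ := Module.projective_lifting_property c LinearMap.id hc
      refine Module.Projective.of_split (LinearMap.ker c).subtype
        ((LinearMap.id - s ∘ₗ c).codRestrict _ fun x ↦ ?_) ?_
      · ext x
        simp
      · have : c (s (c x)) = c x := LinearMap.congr_fun hs (c x)
        simp [this]
    have : Module.Finite R (LinearMap.ker c) :=
      Module.Finite.iff_fg.mpr (Module.FinitePresentation.fg_ker c hc)
    exact Module.finitePresentation_of_projective R _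
  have hle : LinearMap.ker c ≤ LinearMap.ker g := fun x hx ↦ by
    simp [g, LinearMap.mem_ker.mp hx]
  have : Module.FinitePresentation R (LinearMap.ker r) := by
    have e : LinearMap.ker r = (LinearMap.ker c).comap (LinearMap.ker g).subtype :=
      (LinearMap.ker_codRestrict _ _ _).trans (LinearMap.ker_comp _ _)
    rw [e]
    exact (LinearEquiv.finitePresentation_iff
      (M := (LinearMap.ker c).comap (LinearMap.ker g).subtype) (N := LinearMap.ker c)
      (Submodule.comapSubtypeEquivOfLe hle)).mpr this
  exact Module.finitePresentation_of_ker r hr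

/-! ### Bounding projective dimension by cyclic modules -/

open CategoryTheory.Abelian

lemma ModuleCat.injective_of_ext_one_quotient {R : Type u} [CommRing R] (N : ModuleCat.{u} R)
    (h : ∀ I : Ideal R, Subsingleton (Ext (ModuleCat.of R (R ⧸ I)) N 1)) : Injective N := by
  rw [← Module.injective_iff_injective_object]
  refine Module.Baer.injective fun I g ↦ ?_
  let S : ShortComplex (ModuleCat.{u} R) :=
    ModuleCat.shortComplexOfCompEqZero I.subtype I.mkQ
      (LinearMap.exact_subtype_mkQ I).linearMap_comp_eq_zero
  have hS : S.ShortExact := ModuleCat.shortComplex_shortExact S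
    (LinearMap.exact_subtype_mkQ I) (Submodule.injective_subtype _) (Submodule.mkQ_surjective _)
  have := h I
  obtain ⟨φ, hφ⟩ := Ext.contravariant_sequence_exact₁ hS N
    (Ext.mk₀ (ModuleCat.ofHom g)) (zero_add 1) (Subsingleton.elim (α := Ext (ModuleCat.of R (R ⧸ I)) N 1) _ _)
  obtain ⟨φ, rfl⟩ := Ext.homEquiv₀.symm.surjective φ
  have h2 : S.f ≫ φ = ModuleCat.ofHom g := Ext.homEquiv₀.symm.injective (by simpa using hφ)
  refine ⟨φ.hom, fun x hx ↦ ?_⟩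
  exact LinearMap.congr_fun (congr_arg ModuleCat.Hom.hom h2) ⟨x, hx⟩

/-- Dimension shifting through the cokernel of an embedding into an injective reduces to Baer's
criterion. -/
lemma ModuleCat.hasInjectiveDimensionLE_of_ext_quotient {R : Type u} [CommRing R] (n : ℕ)
    (N : ModuleCat.{u} R)
    (h : ∀ I : Ideal R, Subsingleton (Ext (ModuleCat.of R (R ⧸ I)) N (n + 1))) :
    HasInjectiveDimensionLE N n := by
  induction n generalizing N with
  | zero =>
    exact injective_iff_hasInjectiveDimensionLT_one.mp (injective_of_ext_one_quotient N h)
  | succ n ih =>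
    let ⟨p⟩ := EnoughInjectives.presentation N
    have hS : (ShortComplex.mk _ _ (Limits.cokernel.condition p.f)).ShortExact :=
      { exact := ShortComplex.exact_cokernel p.f }
    have := ih (Limits.cokernel p.f) fun I ↦ by
      refine subsingleton_of_forall_eq 0 fun e ↦ ?_
      obtain ⟨x, rfl⟩ := Ext.covariant_sequence_exact₃ _ hS e rfl
        ((h I).elim _ _)
      rw [Ext.eq_zero_of_injective x, Ext.zero_comp]
    exact hS.hasInjectiveDimensionLT_X₁ (n + 1) this inferInstance

/-- Auslander's theorem: projective dimensions are bounded by those of the cyclic modules. -/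
theorem ModuleCat.hasProjectiveDimensionLE_of_quotient {R : Type u} [CommRing R] (n : ℕ)
    (h : ∀ I : Ideal R, HasProjectiveDimensionLE (ModuleCat.of R (R ⧸ I)) n)
    (E : ModuleCat.{u} R) : HasProjectiveDimensionLE E n := by
  refine (hasProjectiveDimensionLT_iff E (n + 1)).mpr fun i hi N e ↦ ?_
  -- The bound passes through the second variable: it limits the injective dimension of every N,
  -- which kills Ext(E, N) for every E.
  have := hasInjectiveDimensionLE_of_ext_quotient n N fun I ↦
    (h I).subsingleton _ _ _ le_rfl N
  exact e.eq_zero_of_hasInjectiveDimensionLT (n + 1) hi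

/-! ### Ring structure of the amalgamation -/

namespace Amalg

section Amalgamation

variable {A : Type u} {B : Type v} [CommRing A] [CommRing B] (f : A →+* B) (J : Ideal B)

/-- The projection `A ⋈^f J → A`. -/
def amalgamationFst : amalgamation f J →+* A :=
  (RingHom.fst A B).comp (amalgamation f J).subtype

/-- The projection `A ⋈^f J → f(A) + J`. -/
def amalgamationSnd : amalgamation f J →+* rangeAdd f J :=
  ((RingHom.snd A B).comp (amalgamation f J).subtype).codRestrict (rangeAdd f J) <| by
    rintro ⟨_, a, j, hj, rfl⟩
    exact ⟨a, j, hj, rfl⟩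

variable {f J}

lemma sub_mem_of_mem_amalgamation (x : amalgamation f J) : x.1.2 - f x.1.1 ∈ J := by
  obtain ⟨_, a, j, hj, rfl⟩ := x
  simpa using hj

lemma mul_eq_zero_of_sq_eq_bot (hJJ : J ^ 2 = ⊥) {j k : B} (hj : j ∈ J) (hk : k ∈ J) :
    j * k = 0 := by
  have := Ideal.mul_mem_mul hj hk
  rwa [← sq, hJJ, Ideal.mem_bot] at this

lemma isLocalHom_amalgamationFst (hJJ : J ^ 2 = ⊥) : IsLocalHom (amalgamationFst f J) := by
  refine ⟨?_⟩
  rintro ⟨_, a, j, hj, rfl⟩ ha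
  obtain ⟨b, hb⟩ := isUnit_iff_exists_inv.mp (show IsUnit a from ha)
  refine IsUnit.of_mul_eq_one
    -- First-order inverse of f a + j, exact because j² = 0.
    ⟨(b, f b + -(f b * f b * j)), b, _, J.neg_mem (J.mul_mem_left _ hj), rfl⟩ ?_
  have h1 : f a * f b = 1 := by rw [← map_mul, hb, map_one]
  have h2 := mul_eq_zero_of_sq_eq_bot hJJ hj hj
  refine Subtype.ext (Prod.ext hb ?_)
  change (f a + j) * (f b + -(f b * f b * j)) = 1
  linear_combination (1 - f b * j) * h1 - f b * f b * h2

lemma isLocalRing_amalgamation [IsLocalRing A] (hJJ : J ^ 2 = ⊥) :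
    IsLocalRing (amalgamation f J) :=
  have := isLocalHom_amalgamationFst (f := f) hJJ
  (amalgamationFst f J).domain_isLocalRing

lemma fst_mem_maximalIdeal [IsLocalRing A] [IsLocalRing (amalgamation f J)]
    {x : amalgamation f J} (hx : x ∈ IsLocalRing.maximalIdeal (amalgamation f J))
    (hJJ : J ^ 2 = ⊥) : x.1.1 ∈ IsLocalRing.maximalIdeal A :=
  have := isLocalHom_amalgamationFst (f := f) hJJ
  fun h ↦ hx (isUnit_of_map_unit (amalgamationFst f J) x h)

lemma mul_eq_zero_of_mem_ker_amalgamationFst [IsLocalRing A] [IsLocalRing (amalgamation f J)]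
    (hMJ : ∀ m ∈ IsLocalRing.maximalIdeal A, ∀ j ∈ J, f m * j = 0) (hJJ : J ^ 2 = ⊥)
    (t : amalgamation f J) (ht : t ∈ RingHom.ker (amalgamationFst f J))
    (m : amalgamation f J) (hm : m ∈ IsLocalRing.maximalIdeal (amalgamation f J)) :
    t * m = 0 := by
  have ht1 : t.1.1 = 0 := ht
  have ht2 : t.1.2 ∈ J := by simpa [ht1] using sub_mem_of_mem_amalgamation t
  refine Subtype.ext (Prod.ext ?_ ?_)
  · change t.1.1 * m.1.1 = 0
    rw [ht1, zero_mul]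
  · change t.1.2 * m.1.2 = 0
    linear_combination mul_eq_zero_of_sq_eq_bot hJJ ht2 (sub_mem_of_mem_amalgamation m) +
      hMJ _ (fst_mem_maximalIdeal hm hJJ) _ ht2

/-- Finite generation of 0 × J would pass to J through this image. -/
lemma map_ker_amalgamationFst :
    (RingHom.ker (amalgamationFst f J)).map (amalgamationSnd f J) = idealOfRangeAdd f J := by
  refine le_antisymm (Ideal.map_le_iff_le_comap.mpr fun t ht ↦ ?_) ?_
  · have ht1 : t.1.1 = 0 := ht
    change t.1.2 ∈ J
    simpa [ht1] using sub_mem_of_mem_amalgamation t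
  · rintro ⟨j, hj'⟩ (hj : j ∈ J)
    have h : ((0 : A), j) ∈ amalgamation f J := ⟨0, j, hj, by simp⟩
    exact Ideal.mem_map_of_mem (amalgamationSnd f J)
      (show (⟨_, h⟩ : amalgamation f J) ∈ RingHom.ker (amalgamationFst f J) from rfl)

lemma not_fg_ker_amalgamationFst (hJfg : ¬ (idealOfRangeAdd f J).FG) :
    ¬ (RingHom.ker (amalgamationFst f J)).FG := fun h ↦
  hJfg (map_ker_amalgamationFst (f := f) (J := J) ▸ h.map _)

/-- The retraction `(m, f m + j) ↦ (0, j)` of the maximal ideal of `A ⋈^f J` onto `0 × J`. -/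
def retraction [IsLocalRing A] [IsLocalRing (amalgamation f J)]
    (hMJ : ∀ m ∈ IsLocalRing.maximalIdeal A, ∀ j ∈ J, f m * j = 0) (hJJ : J ^ 2 = ⊥) :
    IsLocalRing.maximalIdeal (amalgamation f J) →ₗ[amalgamation f J]
      RingHom.ker (amalgamationFst f J) where
  toFun x := ⟨⟨(0, x.1.1.2 - f x.1.1.1), 0, _, sub_mem_of_mem_amalgamation x.1, by simp⟩, rfl⟩
  map_add' x y := by
    refine Subtype.ext (Subtype.ext (Prod.ext (zero_add 0).symm ?_))
    change x.1.1.2 + y.1.1.2 - f (x.1.1.1 + y.1.1.1) = _ - _ + (_ - _)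
    rw [map_add]
    ring
  map_smul' c x := by
    refine Subtype.ext (Subtype.ext (Prod.ext (mul_zero _).symm ?_))
    change c.1.2 * x.1.1.2 - f (c.1.1 * x.1.1.1) = c.1.2 * (x.1.1.2 - f x.1.1.1)
    rw [map_mul]
    -- The defect of linearity is f(x₁)(c₂ - f c₁), which lies in f(M)J = 0.
    linear_combination hMJ _ (fst_mem_maximalIdeal x.2 hJJ) _ (sub_mem_of_mem_amalgamation c)

lemma retraction_apply_of_mem [IsLocalRing A] [IsLocalRing (amalgamation f J)]
    (hMJ : ∀ m ∈ IsLocalRing.maximalIdeal A, ∀ j ∈ J, f m * j = 0) (hJJ : J ^ 2 = ⊥)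
    (x : IsLocalRing.maximalIdeal (amalgamation f J))
    (hx : (x : amalgamation f J) ∈ RingHom.ker (amalgamationFst f J)) :
    (retraction hMJ hJJ x : amalgamation f J) = x := by
  have h : x.1.1.1 = 0 := hx
  refine Subtype.ext (Prod.ext h.symm ?_)
  change x.1.1.2 - f x.1.1.1 = x.1.1.2
  rw [h, map_zero, sub_zero]

end Amalgamation

lemma hasProjectiveDimensionLE_of_globalDimension_eq {R : Type u} [CommRing R] {d : ℕ}
    (h : globalDimension R = d) (E : ModuleCat.{u} R) : HasProjectiveDimensionLE E d := by
  have hne : {n : ℕ∞ | ∀ E : ModuleCat.{u} R, projectiveDimension E ≤ n}.Nonempty := by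
    by_contra! h0
    rw [globalDimension, h0, sInf_empty] at h
    exact ENat.top_ne_natCast d h
  have := csInf_mem hne
  rw [← globalDimension, h] at this
  exact (projectiveDimension_le_iff E d).mp (this E)

lemma globalDimension_le {R : Type u} [CommRing R] {n : ℕ}
    (h : ∀ E : ModuleCat.{u} R, HasProjectiveDimensionLE E n) : globalDimension R ≤ n :=
  sInf_le fun E ↦ (projectiveDimension_le_iff E n).mpr (h E)

end Amalg

/-! ### Modules over a ring C ≅ R × S -/

namespace Amalg

section Product

variable {C : Type (max u w)} {R : Type u} {S : Type w} [CommRing C] [CommRing R] [CommRing S]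
  [Algebra C R] [Algebra C S]

lemma projective_of_bijective_prod
    (h : Function.Bijective ((Algebra.linearMap C R).prod (Algebra.linearMap C S))) :
    Module.Projective C R ∧ Module.Projective C S := by
  let e := LinearEquiv.ofBijective _ h
  have : Module.Projective C (R × S) := .of_equiv e
  exact ⟨.of_split (LinearMap.inl C R S) (LinearMap.fst C R S) (LinearMap.fst_comp_inl _ _ _),
    .of_split (LinearMap.inr C R S) (LinearMap.snd C R S) (LinearMap.snd_comp_inr _ _ _)⟩

lemma surjective_of_bijective_prod
    (h : Function.Bijective ((Algebra.linearMap C R).prod (Algebra.linearMap C S))) :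
    Function.Surjective (algebraMap C R) ∧ Function.Surjective (algebraMap C S) :=
  ⟨Prod.fst_surjective.comp h.2, Prod.snd_surjective.comp h.2⟩

open TensorProduct in
lemma isNDRing_two_of_bijective_prod
    (h : Function.Bijective ((Algebra.linearMap C R).prod (Algebra.linearMap C S)))
    [IsLocalRing R] {I : Ideal R} (hI : ∀ t ∈ I, ∀ m ∈ IsLocalRing.maximalIdeal R, t * m = 0)
    (hFG : ¬ I.FG) (p : IsLocalRing.maximalIdeal R →ₗ[R] I)
    (hp : ∀ x : IsLocalRing.maximalIdeal R, (x : R) ∈ I → (p x : R) = x)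
    {d : ℕ} (hd : ∀ E : ModuleCat.{w} S, HasProjectiveDimensionLE E d) : IsNDRing 2 d C := by
  obtain ⟨-, hSS⟩ := surjective_of_bijective_prod h
  obtain ⟨hRp, hSp⟩ := projective_of_bijective_prod h
  intro E _ _ hE
  rw [isNPresented_two_iff] at hE
  obtain ⟨n, g, hg, hK⟩ := hE
  have : Module.Finite C E := .of_surjective g hg
  have hfree : Module.Free R (R ⊗[C] E) := by
    refine Module.free_of_exact_of_socle hI hFG p hp
      ((LinearMap.ker g).subtype.baseChange R) (g.baseChange R) ?_ ?_ ?_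
    · exact Module.Flat.lTensor_preserves_injective_linearMap _ (Submodule.injective_subtype _)
    · exact LinearMap.lTensor_surjective R hg
    · exact lTensor_exact R g.exact_subtype_ker_map hg
  have hR : Module.Projective C (R ⊗[C] E) := .restrictScalars_of_isScalarTower C R
  have hR' : HasProjectiveDimensionLE (ModuleCat.of C (R ⊗[C] E)) 0 :=
    ModuleCat.hasProjectiveDimensionLE_zero_iff.mpr hR
  have hS : HasProjectiveDimensionLE (ModuleCat.of C (S ⊗[C] E)) d := by
    rw [ModuleCat.hasProjectiveDimensionLE_restrictScalars_iff C hSS]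
    -- `hd` concerns modules in the universe of S; finite generation replaces S ⊗ E by a quotient of
    -- S^m living there.
    obtain ⟨m, q, hq⟩ := Module.Finite.exists_fin' S (S ⊗[C] E)
    have := hd (ModuleCat.of S ((Fin m → S) ⧸ LinearMap.ker q))
    exact ModuleCat.hasProjectiveDimensionLE_of_linearEquiv
      (M := ModuleCat.of S ((Fin m → S) ⧸ LinearMap.ker q)) (N := ModuleCat.of S (S ⊗[C] E))
      (q.quotKerEquivOfSurjective hq) d
  let e : E ≃ₗ[C] (R ⊗[C] E) × (S ⊗[C] E) :=
    (TensorProduct.lid C E).symm ≪≫ₗ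
      TensorProduct.congr (LinearEquiv.ofBijective _ h) (LinearEquiv.refl C E) ≪≫ₗ
      TensorProduct.prodLeft C C R S E
  rw [projectiveDimension_le_iff]
  let T : ShortComplex (ModuleCat C) :=
    ModuleCat.shortComplexOfCompEqZero (LinearMap.inl C (R ⊗[C] E) (S ⊗[C] E))
      (LinearMap.snd C (R ⊗[C] E) (S ⊗[C] E)) (LinearMap.snd_comp_inl _ _ _)
  have hT : T.ShortExact := ModuleCat.shortComplex_shortExact T Function.Exact.inl_snd
    LinearMap.inl_injective LinearMap.snd_surjective
  have := hT.hasProjectiveDimensionLT_X₂ (d + 1)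
    (hasProjectiveDimensionLT_of_ge _ 1 _ (by omega)) hS
  exact hasProjectiveDimensionLT_of_iso (LinearEquiv.toModuleIso e.symm) (d + 1)

lemma not_isNDRing_one_of_bijective_prod
    (h : Function.Bijective ((Algebra.linearMap C R).prod (Algebra.linearMap C S)))
    [IsLocalRing R] {I : Ideal R} (hI : ∀ t ∈ I, ∀ m ∈ IsLocalRing.maximalIdeal R, t * m = 0)
    (hFG : ¬ I.FG) (p : IsLocalRing.maximalIdeal R →ₗ[R] I)
    (hp : ∀ x : IsLocalRing.maximalIdeal R, (x : R) ∈ I → (p x : R) = x)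
    {d : ℕ} (hd : d ≤ 2) : ¬ IsNDRing 1 d C := by
  obtain ⟨hRS, -⟩ := surjective_of_bijective_prod h
  obtain ⟨hRp, -⟩ := projective_of_bijective_prod h
  intro hC
  obtain ⟨x, hxI, hx⟩ := Submodule.exists_mem_ne_zero_of_ne_bot
    (p := I) (fun h ↦ hFG (h ▸ Submodule.fg_bot))
  have hIm : I ≤ IsLocalRing.maximalIdeal R :=
    IsLocalRing.le_maximalIdeal (fun h ↦ hFG (h ▸ Module.Finite.fg_top))
  refine ModuleCat.not_hasProjectiveDimensionLE_two_quotient_span hI hIm p hp hxI hx ?_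
  let Q := R ⧸ Ideal.span {x}
  have : Module.Finite C R := .of_surjective (Algebra.linearMap C R) hRS
  have : Module.FinitePresentation C R := Module.finitePresentation_of_projective C R
  have hQR : Module.FinitePresentation R Q :=
    Module.finitePresentation_of_surjective (Ideal.span {x}).mkQ (Submodule.mkQ_surjective _)
      (by rw [Submodule.ker_mkQ]; exact Submodule.fg_span_singleton x)
  have hQC : Module.FinitePresentation C Q := .trans C _ R
  have := hC (ULift.{w} Q) (isNPresented_one_iff.mpr (.of_equiv ULift.moduleEquiv.symm))
  rw [projectiveDimension_le_iff] at this
  have h2 : HasProjectiveDimensionLE (ModuleCat.of C (ULift.{w} Q)) 2 :=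
    hasProjectiveDimensionLT_of_ge _ (d + 1) _ (by omega)
  rw [ModuleCat.hasProjectiveDimensionLE_restrictScalars_iff C hRS] at h2
  exact ModuleCat.hasProjectiveDimensionLE_of_linearEquiv
    (M := ModuleCat.of R (ULift.{w} Q)) (N := ModuleCat.of R Q) ULift.moduleEquiv 2

lemma hasProjectiveDimensionLE_of_isNDRing_two
    (h : Function.Bijective ((Algebra.linearMap C R).prod (Algebra.linearMap C S)))
    [IsNoetherianRing S] {n : ℕ} (hC : IsNDRing 2 n C) (E : ModuleCat.{w} S) :
    HasProjectiveDimensionLE E n := by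
  obtain ⟨-, hSS⟩ := surjective_of_bijective_prod h
  obtain ⟨-, hSp⟩ := projective_of_bijective_prod h
  refine ModuleCat.hasProjectiveDimensionLE_of_quotient n (fun I ↦ ?_) E
  let Q := S ⧸ I
  have hQ : IsNPresented 2 S (ULift.{u} Q) := by
    have : Module.Finite S Q := .of_surjective I.mkQ I.mkQ_surjective
    obtain ⟨m, q, hq⟩ := Module.Finite.exists_fin' S (ULift.{u} Q)
    exact isNPresented_two_iff.mpr ⟨m, q, hq, Module.finitePresentation_of_finite S _⟩
  have := hC (ULift.{u} Q) (hQ.two_restrictScalars C hSS)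
  rw [projectiveDimension_le_iff,
    ModuleCat.hasProjectiveDimensionLE_restrictScalars_iff C hSS] at this
  exact ModuleCat.hasProjectiveDimensionLE_of_linearEquiv
    (M := ModuleCat.of S (ULift.{u} Q)) (N := ModuleCat.of S Q) ULift.moduleEquiv n

end Product

end Amalg

theorem corollary3p2
    {A : Type u} {B : Type v} {A₂ : Type w} [CommRing A] [CommRing B] [CommRing A₂]
    [IsLocalRing A] [IsNoetherianRing A₂]
    (f : A →+* B) (J : Ideal B) (hJ : J ≠ ⊤)
    (hMJ : ∀ m ∈ IsLocalRing.maximalIdeal A, ∀ j ∈ J, f m * j = 0)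
    (hJJ : J ^ 2 = ⊥)
    (hJfg : ¬ (Amalg.idealOfRangeAdd f J).FG)
    (d : ℕ) (hd : d ≤ 2) (hA₂ : Amalg.globalDimension A₂ = d) :
    Amalg.IsNDRing 2 d (Amalg.amalgamation f J × A₂) ∧
    ¬ Amalg.IsNDRing 1 d (Amalg.amalgamation f J × A₂) ∧
    (1 ≤ d → ¬ Amalg.IsNDRing 2 (d - 1) (Amalg.amalgamation f J × A₂)) := by
  have := Amalg.isLocalRing_amalgamation (f := f) hJJ
  let : Algebra (Amalg.amalgamation f J × A₂) (Amalg.amalgamation f J) :=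
    (RingHom.fst _ _).toAlgebra
  let : Algebra (Amalg.amalgamation f J × A₂) A₂ := (RingHom.snd _ _).toAlgebra
  have h : Function.Bijective
      ((Algebra.linearMap (Amalg.amalgamation f J × A₂) (Amalg.amalgamation f J)).prod
        (Algebra.linearMap (Amalg.amalgamation f J × A₂) A₂)) := Function.bijective_id
  have hI := Amalg.mul_eq_zero_of_mem_ker_amalgamationFst (f := f) hMJ hJJ
  have hFG := Amalg.not_fg_ker_amalgamationFst hJfg
  have hp := Amalg.retraction_apply_of_mem (f := f) hMJ hJJ
  refine ⟨Amalg.isNDRing_two_of_bijective_prod h hI hFG _ hp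
      (Amalg.hasProjectiveDimensionLE_of_globalDimension_eq hA₂),
    Amalg.not_isNDRing_one_of_bijective_prod h hI hFG _ hp hd, fun hd1 hC ↦ ?_⟩
  have hle := Amalg.globalDimension_le (Amalg.hasProjectiveDimensionLE_of_isNDRing_two h hC)
  rw [hA₂, Nat.cast_le] at hle
  omega
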